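/- Let $1\le p\le\infty$, $\mathbb N_0=\{0,1,2,\dots\}$, $\mathbb N=\{1,2,\dots\}$; all sequences are complex. An infinite matrix $(M_{j,k})_{j,k\in J}$ ($J=\mathbb Z$ or $J=\mathbb N_0$) *generates a bounded operator* on $\ell^p(J)$ if there is a constant $c>0$ such that for every $x\in\ell^p(J)$ the series $y_j=\sum_{k\in J}M_{j,k}x_k$ converge and define a sequence $y\in\ell^p(J)$ with $\|y\|\le c\|x\|$; the operator $x\mapsto y$ is then denoted by the same letter as the matrix. For sequences $\varphi=(\varphi_n)_{n\in\mathbb Z}$ and $\psi=(\psi_n)_{n\in\mathbb N}$ put $$L(\varphi)=(\varphi_{j-k})_{j,k\in\mathbb Z},\qquad T(\varphi)=(\varphi_{j-k})_{j,k\in\mathbb N_0},\qquad H(\psi)=(\psi_{j+k+1})_{j,k\in\mathbb N_0}.$$ Let $M^p$ be the set of all $a\in L^1(\mathbb T)$, with sequence of Fourier coefficients $\hat a=(\hat a_n)_{n\in\mathbb Z}$, such that $L(\hat a)$ generates a bounded operator on $\ell^p(\mathbb Z)$, and let $\|a\|_{M^p}$ be the norm of that operator. A linear operator $A$ on $\ell^p(\mathbb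 N_0)$ has entries $A_{j,k}=(Ae_k)_j$, where $(e_k)$ are the standard unit sequences, and *has a matrix representation* if $(Ax)_j=\sum_{k\in\mathbb N_0}A_{j,k}x_k$ for all $x\in\ell^p(\mathbb N_0)$ and $j\in\mathbb N_0$ (for bounded $A$ and $p<\infty$ this always holds). For a bounded operator $A$ on $\ell^p(\mathbb N_0)$ let $\|A\|_{\mathrm{ess}}=\inf\{\|A+K\| : K \text{ a compact operator on } \ell^p(\mathbb N_0)\}$. For every linear operator $A$ on $\ell^p(\mathbb N_0)$ the following statements are equivalent: (i) $A$ is bounded, has a matrix representation, and its entries satisfy the displacement relations $$A_{j-1,k}+A_{j+1,k}-A_{j,k-1}-A_{j,k+1}=0\qquad(j,k\in\mathbb N).$$ (ii) $A$ is bounded, has a matrix representation, and its matrix equals $T(\varphi)+H(\psi)$ for some $\varphi\in\ell^\infty(\mathbb Z)$ and $\psi\in\ell^\infty(\mathbb N)$. (iii) $A=T(\hat a)+H(\varrho)$ for some $a\in M^p$ and some $\varrho\in c_0(\mathbb N)$ such that $H(\varrho)$ generates a bounded operator on $\ell^p(\mathbb N_0)$. The function $a$ and the sequence $\varrho$ in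 (iii) are uniquely determined. Moreover, there are constants $c,C>0$, not depending on $a$ and $\varrho$, such that for all $a\in M^p$ and all $\varrho\in c_0(\mathbb N)$ with $H(\varrho)$ bounded on $\ell^p(\mathbb N_0)$ $$c\,\max\{\|a\|_{M^p},\|H(\varrho)\|\}\le\|T(\hat a)+H(\varrho)\|\le C\max\{\|a\|_{M^p},\|H(\varrho)\|\},$$ $$c\,\max\{\|a\|_{M^p},\|H(\varrho)\|_{\mathrm{ess}}\}\le\|T(\hat a)+H(\varrho)\|_{\mathrm{ess}}\le C\max\{\|a\|_{M^p},\|H(\varrho)\|_{\mathrm{ess}}\}.$$ -/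

import Mathlib

open scoped ENNReal Topology
open Filter

noncomputable section

namespace ToeplitzHankel

/-- `ℓ^p(J)`: complex sequences indexed by `J` (below `J = ℕ`, playing the role of `ℕ₀`,
or `J = ℤ`). -/
abbrev ell (p : ℝ≥0∞) (J : Type) : Type := lp (fun _ : J => ℂ) p

section Matrices

variable {p : ℝ≥0∞} {J : Type}

/-- The infinite matrix `M` generates a bounded linear operator on `ℓ^p(J)`: there is a positive
constant `c` such that for every `x ∈ ℓ^p(J)` the sequence `y_j = ∑_k M_{j,k} x_k` is defined
(all series converge), belongs to `ℓ^p(J)` and satisfies `‖y‖ ≤ c ‖x‖`. -/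
def GeneratesBounded (p : ℝ≥0∞) (M : Matrix J J ℂ) : Prop :=
  ∃ c : ℝ, 0 < c ∧ ∀ x : ell p J, ∃ y : ell p J,
    (∀ j, HasSum (fun k => M j k * x k) (y j)) ∧ ‖y‖ ≤ c * ‖x‖

theorem GeneratesBounded.hasSum {M : Matrix J J ℂ} (h : GeneratesBounded p M) (x : ell p J)
    (j : J) : HasSum (fun k => M j k * x k) (∑' k, M j k * x k) := by
  obtain ⟨c, _, H⟩ := h
  obtain ⟨y, hy, _⟩ := H x
  exact (hy j).summable.hasSum

theorem GeneratesBounded.memℓp {M : Matrix J J ℂ} (h : GeneratesBounded p M) (x : ell p J) :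
    Memℓp (fun j => ∑' k, M j k * x k) p := by
  obtain ⟨c, _, H⟩ := h
  obtain ⟨y, hy, _⟩ := H x
  have e : (fun j => ∑' k, M j k * x k) = ⇑y := funext fun j => (hy j).tsum_eq
  rw [e]
  exact lp.memℓp y

variable [Fact (1 ≤ p)]

/-- The bounded linear operator on `ℓ^p(J)` generated by the matrix `M`:
`(M x)_j = ∑_k M_{j,k} x_k`. -/
def generatedOp {M : Matrix J J ℂ} (h : GeneratesBounded p M) : ell p J →L[ℂ] ell p J :=
  LinearMap.mkContinuousOfExistsBound
    { toFun := fun x => ⟨fun j => ∑' k, M j k * x k, h.memℓp x⟩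
      map_add' := by
        intro x y
        ext j
        change ∑' k, M j k * (x + y) k = ∑' k, M j k * x k + ∑' k, M j k * y k
        rw [← ((h.hasSum x j).add (h.hasSum y j)).tsum_eq]
        simp [mul_add]
      map_smul' := by
        intro a x
        ext j
        change ∑' k, M j k * (a • x) k = a * ∑' k, M j k * x k
        rw [← ((h.hasSum x j).mul_left a).tsum_eq]
        simp [mul_left_comm] }
    (by
      obtain ⟨c, _, H⟩ := h
      refine ⟨c, fun x => ?_⟩
      obtain ⟨y, hy, hle⟩ := H x
      refine le_trans (le_of_eq ?_) hle
      congr 1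
      ext j
      exact (hy j).tsum_eq)

theorem generatedOp_apply {M : Matrix J J ℂ} (h : GeneratesBounded p M) (x : ell p J) (j : J) :
    generatedOp h x j = ∑' k, M j k * x k := rfl

/-- The matrix entry `A_{j,k} = ⟨A e_k, e_j⟩` of a linear operator `A` on `ℓ^p(ℕ₀)`. -/
def matrixOf (A : ell p ℕ →ₗ[ℂ] ell p ℕ) : Matrix ℕ ℕ ℂ :=
  fun j k => A (lp.single p k 1) j

/-- The linear operator `A` is given by its matrix: `(A x)_j = ∑_k A_{j,k} x_k` for all `x`.
For bounded `A` this is automatic if `p < ∞`, but not if `p = ∞`. -/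
def IsMatrixRepresented (A : ell p ℕ →ₗ[ℂ] ell p ℕ) : Prop :=
  ∀ (x : ell p ℕ) (j : ℕ), HasSum (fun k => matrixOf A j k * x k) (A x j)

/-- The displacement relations `A_{j-1,k} + A_{j+1,k} - A_{j,k-1} - A_{j,k+1} = 0` for
`j, k ≥ 1`. -/
def DisplacementRelations (M : Matrix ℕ ℕ ℂ) : Prop :=
  ∀ j k : ℕ, 1 ≤ j → 1 ≤ k → M (j - 1) k + M (j + 1) k - M j (k - 1) - M j (k + 1) = 0

/-- The essential norm `‖A‖_ess = inf {‖A + K‖ : K compact}`. -/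
def essNorm (A : ell p ℕ →L[ℂ] ell p ℕ) : ℝ :=
  sInf {r : ℝ | ∃ K : ell p ℕ →L[ℂ] ell p ℕ, IsCompactOperator K ∧ r = ‖A + K‖}

end Matrices

/-- The Laurent matrix `L(φ)_{j,k} = φ_{j-k}`, `j, k ∈ ℤ`. -/
def laurent (φ : ℤ → ℂ) : Matrix ℤ ℤ ℂ := fun j k => φ (j - k)

/-- The Toeplitz matrix `T(φ)_{j,k} = φ_{j-k}`, `j, k ∈ ℕ₀`. -/
def toeplitz (φ : ℤ → ℂ) : Matrix ℕ ℕ ℂ := fun j k => φ ((j : ℤ) - (k : ℤ))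

/-- The Hankel matrix `H(ψ)_{j,k} = ψ_{j+k+1}`, `j, k ∈ ℕ₀`, of a sequence `ψ` indexed by the
positive integers. -/
def hankel (ψ : ℕ+ → ℂ) : Matrix ℕ ℕ ℂ := fun j k => ψ (Nat.succPNat (j + k))

/-- `L^1` of the unit circle (parametrized by `t ∈ ℝ/ℤ`, `t ↦ exp(2πit)`, with normalized Haar
measure). -/
abbrev L1Circle : Type := MeasureTheory.Lp ℂ 1 (AddCircle.haarAddCircle (T := (1 : ℝ)))

/-- The sequence `â` of Fourier coefficients of `a ∈ L^1`. -/
def fourierSeq (a : L1Circle) : ℤ → ℂ := fun n => fourierCoeff (a : AddCircle (1 : ℝ) → ℂ) n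

/-- The class `M^p` of all `a ∈ L^1` for which `L(â)` generates a bounded operator on `ℓ^p(ℤ)`. -/
def Mp (p : ℝ≥0∞) : Type := {a : L1Circle // GeneratesBounded p (laurent (fourierSeq a))}

/-- The sequences `ϱ ∈ c₀(ℕ)`, `ℕ = {1, 2, …}`, for which `H(ϱ)` is bounded on `ℓ^p(ℕ₀)`. -/
def HankelSymbol (p : ℝ≥0∞) : Type :=
  {ϱ : ℕ+ → ℂ // Tendsto ϱ atTop (𝓝 0) ∧ GeneratesBounded p (hankel ϱ)}

/-- Extension of a sequence on `ℕ₀` by zero to `ℤ`. -/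
theorem exists_zeroExtension {p : ℝ≥0∞} [Fact (1 ≤ p)] (x : ell p ℕ) :
    ∃ x' : ell p ℤ, (∀ n : ℕ, x' (n : ℤ) = x n) ∧ (∀ n : ℤ, n ∉ Set.range (Nat.cast : ℕ → ℤ) →
      x' n = 0) ∧ ‖x'‖ ≤ ‖x‖ := by
  have inj : Function.Injective (Nat.cast : ℕ → ℤ) := Nat.cast_injective
  have h1 : ∀ n : ℕ, Function.extend (Nat.cast : ℕ → ℤ) x (0 : ℤ → ℂ) (n : ℤ) = x n :=
    fun n => inj.extend_apply _ _ n
  have h2 : ∀ n : ℤ, n ∉ Set.range (Nat.cast : ℕ → ℤ) →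
      Function.extend (Nat.cast : ℕ → ℤ) x (0 : ℤ → ℂ) n = 0 :=
    fun n hn => Function.extend_apply' _ _ _ hn
  rcases eq_or_ne p ∞ with rfl | hp
  · have hb : ∀ n : ℤ, ‖Function.extend (Nat.cast : ℕ → ℤ) x (0 : ℤ → ℂ) n‖ ≤ ‖x‖ := by
      intro n
      by_cases hn : n ∈ Set.range (Nat.cast : ℕ → ℤ)
      · obtain ⟨m, rfl⟩ := hn
        rw [h1]
        exact lp.norm_apply_le_norm ENNReal.top_ne_zero x m
      · rw [h2 n hn, norm_zero]
        exact norm_nonneg _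
    refine ⟨⟨_, memℓp_infty ⟨‖x‖, ?_⟩⟩, h1, h2, lp.norm_le_of_forall_le (norm_nonneg _) hb⟩
    rintro _ ⟨n, rfl⟩
    exact hb n
  · have hp0 : 0 < p.toReal :=
      ENNReal.toReal_pos (zero_lt_one.trans_le Fact.out).ne' hp
    have hs : HasSum (fun n : ℤ =>
        ‖Function.extend (Nat.cast : ℕ → ℤ) x (0 : ℤ → ℂ) n‖ ^ p.toReal) (‖x‖ ^ p.toReal) := by
      rw [← inj.hasSum_iff]
      · convert lp.hasSum_norm hp0 x using 2 with n
        simp only [Function.comp, h1]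
      · intro n hn
        rw [h2 n hn, norm_zero, Real.zero_rpow hp0.ne']
    refine ⟨⟨_, memℓp_gen hs.summable⟩, h1, h2, ?_⟩
    exact lp.norm_le_of_tsum_le hp0 (norm_nonneg _) hs.tsum_eq.le

/-- Restriction of a sequence on `ℤ` to `ℕ₀`. -/
theorem exists_restriction {p : ℝ≥0∞} [Fact (1 ≤ p)] (y : ell p ℤ) :
    ∃ y' : ell p ℕ, (∀ n : ℕ, y' n = y (n : ℤ)) ∧ ‖y'‖ ≤ ‖y‖ := by
  have inj : Function.Injective (Nat.cast : ℕ → ℤ) := Nat.cast_injective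
  rcases eq_or_ne p ∞ with rfl | hp
  · have hb : ∀ n : ℕ, ‖y (n : ℤ)‖ ≤ ‖y‖ := fun n =>
      lp.norm_apply_le_norm ENNReal.top_ne_zero y _
    refine ⟨⟨fun n => y (n : ℤ), memℓp_infty ⟨‖y‖, ?_⟩⟩, fun _ => rfl,
      lp.norm_le_of_forall_le (norm_nonneg _) hb⟩
    rintro _ ⟨n, rfl⟩
    exact hb n
  · have hp0 : 0 < p.toReal :=
      ENNReal.toReal_pos (zero_lt_one.trans_le Fact.out).ne' hp
    have hs := (lp.hasSum_norm hp0 y).summable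
    have hs' : Summable fun n : ℕ => ‖y (n : ℤ)‖ ^ p.toReal := hs.comp_injective inj
    refine ⟨⟨fun n => y (n : ℤ), memℓp_gen hs'⟩, fun _ => rfl,
      lp.norm_le_of_tsum_le hp0 (norm_nonneg _) ?_⟩
    rw [lp.norm_rpow_eq_tsum hp0 y]
    exact hs'.tsum_le_tsum_of_inj _ inj
      (fun _ _ => Real.rpow_nonneg (norm_nonneg _) _) (fun _ => le_rfl) hs

/-- If `L(φ)` is bounded on `ℓ^p(ℤ)`, then its compression `T(φ)` is bounded on `ℓ^p(ℕ₀)`. -/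
theorem GeneratesBounded.toeplitz {p : ℝ≥0∞} [Fact (1 ≤ p)] {φ : ℤ → ℂ}
    (h : GeneratesBounded p (laurent φ)) : GeneratesBounded p (toeplitz φ) := by
  obtain ⟨c, hc, H⟩ := h
  refine ⟨c, hc, fun x => ?_⟩
  obtain ⟨x', hx1, hx2, hx3⟩ := exists_zeroExtension x
  obtain ⟨y, hy1, hy2⟩ := H x'
  obtain ⟨z, hz1, hz2⟩ := exists_restriction y
  refine ⟨z, fun j => ?_, hz2.trans (hy2.trans (by gcongr))⟩
  have := hy1 (j : ℤ)
  rw [← (Nat.cast_injective (R := ℤ)).hasSum_iff] at this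
  · rw [hz1]
    convert this using 2 with k
    simp [hx1, laurent, ToeplitzHankel.toeplitz]
  · intro n hn
    rw [hx2 n hn, mul_zero]

section Operators

variable {p : ℝ≥0∞} [Fact (1 ≤ p)]

/-- The norm `‖a‖_{M^p} = ‖L(a)‖`, the operator norm on `ℓ^p(ℤ)`. -/
def Mp.norm (a : Mp p) : ℝ := ‖generatedOp a.2‖

/-- The Toeplitz operator `T(â)` on `ℓ^p(ℕ₀)`, `a ∈ M^p`. -/
def toeplitzOp (a : Mp p) : ell p ℕ →L[ℂ] ell p ℕ := generatedOp a.2.toeplitz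

/-- The Hankel operator `H(ϱ)` on `ℓ^p(ℕ₀)`. -/
def hankelOp (ϱ : HankelSymbol p) : ell p ℕ →L[ℂ] ell p ℕ := generatedOp ϱ.2.2

end Operators

end ToeplitzHankel

end

open ToeplitzHankel

noncomputable section

namespace ToeplitzHankel

/-! The displacement relations say that $A_{j+1,k+1}-A_{j,k}$ depends only on $j+k$. Subtracting a
suitable function $d(j+k)$ therefore leaves a matrix constant along diagonals, which gives
$T(\varphi)+H(\psi)$ with bounded symbols. This splitting is ambiguous: a function of the parity of
$j+k$ is also a function of $j-k$. To normalize it, follow $A_{j+n,k+n}=\varphi_{j-k}+d(j+k+2n)$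
along a free ultrafilter of $n$, where bounded scalar sequences converge without passing to
subsequences. The columns of $A$ (for $p<\infty$) or its rows (for $p=\infty$) tend to zero, so
$d(n+2)-d(n)\to0$. Hence the limit of $d(j+k+2n)$ is some $\alpha_{j+k}$ depending only on parity,
and $\alpha_{j+k}=\alpha_{j-k}$ can be moved into the Toeplitz part. The limit matrix
$L(\varphi+\alpha)$ comes from shifted copies of $A$ of norm at most $\|A\|$, so it is bounded on
$\ell^p(\mathbb Z)$ (`exists_hasSum_of_tendsto`). Its symbol is square summable and hence equals
$\hat a$ for some $a\in L^2\subset L^1$. The remainder is a bounded Hankel operator, and such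
operators have symbols in $c_0$. For the norms, the same limit applied to $T(\hat a)+H(\varrho)+K$
with $K$ compact leaves only $L(\hat a)$, since the entries of $H(\varrho)$ and $K$ vanish along
diagonals (`Mp.norm_le_norm_add`). The rest is the triangle inequality. -/

theorem sum_single_apply {p : ℝ≥0∞} {J : Type} [DecidableEq J] (u : J → ℂ) (s : Finset J) (j : J) :
    (∑ k ∈ s, lp.single p k (u k) : ell p J) j = if j ∈ s then u j else 0 := by
  rw [lp.coeFn_sum, Finset.sum_apply]
  split_ifs with hj
  · rw [Finset.sum_eq_single_of_mem j hj fun b _ hb => lp.single_apply_ne _ _ _ hb.symm]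
    simp
  · exact Finset.sum_eq_zero fun b hb => lp.single_apply_ne _ _ _ fun h => hj (h ▸ hb)

/-! ### Reindexing and coordinatewise limits in $\ell^p$. -/

section SequenceSpaces

variable {p : ℝ≥0∞} [Fact (1 ≤ p)] {I J : Type}

theorem zero_lt_exponent : 0 < p := zero_lt_one.trans_le Fact.out

theorem toReal_exponent_pos (hp : p ≠ ∞) : 0 < p.toReal :=
  ENNReal.toReal_pos zero_lt_exponent.ne' hp

theorem exists_eq_comp {f : I → J} (hf : Function.Injective f) (x : ell p J) :
    ∃ y : ell p I, ⇑y = x ∘ f ∧ ‖y‖ ≤ ‖x‖ := by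
  rcases eq_or_ne p ∞ with rfl | hp
  · have hb : ∀ i, ‖x (f i)‖ ≤ ‖x‖ := fun i => lp.norm_apply_le_norm ENNReal.top_ne_zero x _
    refine ⟨⟨fun i => x (f i), memℓp_infty ⟨‖x‖, ?_⟩⟩, rfl,
      lp.norm_le_of_forall_le (norm_nonneg _) hb⟩
    rintro _ ⟨n, rfl⟩
    exact hb n
  · have hp0 := toReal_exponent_pos hp
    have hs := (lp.hasSum_norm hp0 x).summable
    have hs' : Summable fun i => ‖x (f i)‖ ^ p.toReal := hs.comp_injective hf
    refine ⟨⟨fun i => x (f i), memℓp_gen hs'⟩, rfl,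
      lp.norm_le_of_tsum_le hp0 (norm_nonneg _) ?_⟩
    rw [lp.norm_rpow_eq_tsum hp0 x]
    exact hs'.tsum_le_tsum_of_inj _ hf
      (fun _ _ => Real.rpow_nonneg (norm_nonneg _) _) (fun _ => le_rfl) hs

theorem exists_eq_extend {f : I → J} (hf : Function.Injective f) (x : ell p I) :
    ∃ y : ell p J, ⇑y = Function.extend f x (0 : J → ℂ) ∧ ‖y‖ ≤ ‖x‖ := by
  have h1 : ∀ i, Function.extend f x (0 : J → ℂ) (f i) = x i := fun i => hf.extend_apply _ _ i
  have h2 : ∀ j, j ∉ Set.range f → Function.extend f x (0 : J → ℂ) j = 0 :=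
    fun j hj => Function.extend_apply' _ _ _ hj
  rcases eq_or_ne p ∞ with rfl | hp
  · have hb : ∀ j, ‖Function.extend f x (0 : J → ℂ) j‖ ≤ ‖x‖ := by
      intro j
      by_cases hj : j ∈ Set.range f
      · obtain ⟨i, rfl⟩ := hj
        rw [h1]
        exact lp.norm_apply_le_norm ENNReal.top_ne_zero x i
      · rw [h2 j hj, norm_zero]
        exact norm_nonneg _
    refine ⟨⟨_, memℓp_infty ⟨‖x‖, ?_⟩⟩, rfl, lp.norm_le_of_forall_le (norm_nonneg _) hb⟩
    rintro _ ⟨n, rfl⟩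
    exact hb n
  · have hp0 := toReal_exponent_pos hp
    have hs : HasSum (fun j => ‖Function.extend f x (0 : J → ℂ) j‖ ^ p.toReal)
        (‖x‖ ^ p.toReal) := by
      rw [← hf.hasSum_iff]
      · convert lp.hasSum_norm hp0 x using 2 with i
        simp only [Function.comp, h1]
      · intro j hj
        rw [h2 j hj, norm_zero, Real.zero_rpow hp0.ne']
    exact ⟨⟨_, memℓp_gen hs.summable⟩, rfl,
      lp.norm_le_of_tsum_le hp0 (norm_nonneg _) hs.tsum_eq.le⟩

/-- Composition with an injective map of index sets. -/
def lpComp (p : ℝ≥0∞) [Fact (1 ≤ p)] {f : I → J} (hf : Function.Injective f) :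
    ell p J →L[ℂ] ell p I :=
  LinearMap.mkContinuous
    { toFun := fun x => ⟨x ∘ f, by
        obtain ⟨y, hy, _⟩ := exists_eq_comp hf x
        exact hy ▸ lp.memℓp y⟩
      map_add' := fun x y => rfl
      map_smul' := fun c x => rfl }
    1 fun x => by
      obtain ⟨y, hy, hle⟩ := exists_eq_comp hf x
      rw [one_mul]
      exact (lp.norm_mono zero_lt_exponent.ne' fun i => (congrArg norm (congrFun hy i)).ge).trans hle

theorem lpComp_apply {f : I → J} (hf : Function.Injective f) (x : ell p J) (i : I) :
    lpComp p hf x i = x (f i) :=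
  rfl

theorem norm_lpComp_le {f : I → J} (hf : Function.Injective f) : ‖lpComp p hf‖ ≤ 1 :=
  LinearMap.mkContinuous_norm_le _ zero_le_one _

/-- Extension by zero along an injective map of index sets. -/
def lpExt (p : ℝ≥0∞) [Fact (1 ≤ p)] {f : I → J} (hf : Function.Injective f) :
    ell p I →L[ℂ] ell p J :=
  LinearMap.mkContinuous
    { toFun := fun x => ⟨Function.extend f x 0, by
        obtain ⟨y, hy, _⟩ := exists_eq_extend hf x
        exact hy ▸ lp.memℓp y⟩
      map_add' := fun x y => by
        ext j
        change Function.extend f (⇑x + ⇑y) 0 j =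
          Function.extend f x (0 : J → ℂ) j + Function.extend f y (0 : J → ℂ) j
        by_cases hj : ∃ i, f i = j
        · obtain ⟨i, rfl⟩ := hj
          simp [hf.extend_apply]
        · simp [Function.extend_apply' _ _ _ hj]
      map_smul' := fun c x => by
        ext j
        change Function.extend f (c • ⇑x) 0 j = c * Function.extend f x (0 : J → ℂ) j
        by_cases hj : ∃ i, f i = j
        · obtain ⟨i, rfl⟩ := hj
          simp [hf.extend_apply]
        · simp [Function.extend_apply' _ _ _ hj] }
    1 fun x => by
      obtain ⟨y, hy, hle⟩ := exists_eq_extend hf x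
      rw [one_mul]
      exact (lp.norm_mono zero_lt_exponent.ne' fun i => (congrArg norm (congrFun hy i)).ge).trans hle

theorem lpExt_apply {f : I → J} (hf : Function.Injective f) (x : ell p I) (i : I) :
    lpExt p hf x (f i) = x i :=
  hf.extend_apply _ _ i

theorem norm_lpExt_le {f : I → J} (hf : Function.Injective f) : ‖lpExt p hf‖ ≤ 1 :=
  LinearMap.mkContinuous_norm_le _ zero_le_one _

theorem lpComp_single [DecidableEq I] [DecidableEq J] {f : I → J} (hf : Function.Injective f)
    (i : I) (c : ℂ) : lpComp p hf (lp.single p (f i) c) = lp.single p i c := by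
  ext j
  rw [lpComp_apply]
  rcases eq_or_ne j i with rfl | h
  · simp
  · rw [lp.single_apply_ne _ _ _ h, lp.single_apply_ne _ _ _ (hf.ne h)]

theorem lpExt_single [DecidableEq I] [DecidableEq J] {f : I → J} (hf : Function.Injective f)
    (i : I) (c : ℂ) : lpExt p hf (lp.single p i c) = lp.single p (f i) c := by
  ext j
  by_cases hj : ∃ i', f i' = j
  · obtain ⟨i', rfl⟩ := hj
    rw [lpExt_apply]
    rcases eq_or_ne i' i with rfl | h
    · simp
    · rw [lp.single_apply_ne _ _ _ h, lp.single_apply_ne _ _ _ (hf.ne h)]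
  · rw [lp.single_apply_ne _ _ _ fun h => hj ⟨i, h.symm⟩]
    exact Function.extend_apply' _ _ _ hj

theorem norm_sum_single_le [DecidableEq J] {u : J → ℂ} {x : ell p J} {s : Finset J}
    (h : ∀ k ∈ s, ‖u k‖ ≤ ‖x k‖) : ‖(∑ k ∈ s, lp.single p k (u k) : ell p J)‖ ≤ ‖x‖ := by
  refine lp.norm_mono zero_lt_exponent.ne' fun j => ?_
  rw [sum_single_apply]
  split_ifs with hj
  · exact h j hj
  · simp

theorem map_sum_single_apply [DecidableEq I] {B : ell p I →L[ℂ] ell p J} (u : I → ℂ)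
    (s : Finset I) (j : J) :
    B (∑ k ∈ s, lp.single p k (u k)) j = ∑ k ∈ s, B (lp.single p k 1) j * u k := by
  rw [map_sum, lp.coeFn_sum, Finset.sum_apply]
  refine Finset.sum_congr rfl fun k _ => ?_
  have : lp.single p k (u k) = u k • (lp.single p k (1 : ℂ) : ell p I) := by
    rw [← lp.single_smul, smul_eq_mul, mul_one]
  rw [this, map_smul, lp.coeFn_smul, Pi.smul_apply, smul_eq_mul, mul_comm]

theorem exists_of_tendsto {ι : Type*} {l : Filter ι} [l.NeBot] {F : ι → ell p J} {C : ℝ}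
    (hF : ∀ i, ‖F i‖ ≤ C) {f : J → ℂ} (h : ∀ j, Tendsto (fun i => F i j) l (𝓝 (f j))) :
    ∃ y : ell p J, ⇑y = f ∧ ‖y‖ ≤ C := by
  have hb : Bornology.IsBounded (Set.range F) :=
    isBounded_iff_forall_norm_le.2 ⟨C, by rintro _ ⟨i, rfl⟩; exact hF i⟩
  have ht : Tendsto (id fun i => (F i : J → ℂ)) l (𝓝 f) := tendsto_pi_nhds.2 h
  exact ⟨⟨f, lp.memℓp_of_tendsto hb ht⟩, rfl,
    lp.norm_le_of_tendsto (Eventually.of_forall hF) ht⟩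

end SequenceSpaces

/-! ### Entrywise limits of bounded operators. -/

section Limits

variable {p : ℝ≥0∞} [Fact (1 ≤ p)] {J : Type}

/-- If the matrix entries of uniformly bounded operators converge, then the limit matrix generates
a bounded operator, with the same bound. -/
theorem exists_hasSum_of_tendsto [DecidableEq J] {ι : Type*} {l : Filter ι} [l.NeBot]
    {B : ι → ell p J →L[ℂ] ell p J} {C : ℝ} (hB : ∀ i, ‖B i‖ ≤ C) {M : Matrix J J ℂ}
    (hM : ∀ j k, Tendsto (fun i => B i (lp.single p k 1) j) l (𝓝 (M j k))) (x : ell p J) :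
    ∃ y : ell p J, (∀ j, HasSum (fun k => M j k * x k) (y j)) ∧ ‖y‖ ≤ C * ‖x‖ := by
  have hC : 0 ≤ C := by
    obtain ⟨i⟩ := l.nonempty_of_neBot
    exact (norm_nonneg _).trans (hB i)
  -- On finitely supported vectors the bound passes to the entrywise limit, because closed balls of
  -- $\ell^p$ are closed under coordinatewise limits. Allowing any $u$ dominated by $x$ leaves the
  -- phases free.
  have finite : ∀ (s : Finset J) (u : J → ℂ), (∀ k, ‖u k‖ ≤ ‖x k‖) →
      ∃ z : ell p J, (∀ j, z j = ∑ k ∈ s, M j k * u k) ∧ ‖z‖ ≤ C * ‖x‖ := by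
    intro s u hu
    obtain ⟨z, hz, hz'⟩ := exists_of_tendsto
      (F := fun i => B i (∑ k ∈ s, lp.single p k (u k))) (C := C * ‖x‖) (l := l)
      (f := fun j => ∑ k ∈ s, M j k * u k)
      (fun i => ((B i).le_opNorm _).trans
        (mul_le_mul (hB i) (norm_sum_single_le fun k _ => hu k) (norm_nonneg _) hC))
      (fun j => by
        simp_rw [map_sum_single_apply]
        exact tendsto_finsetSum _ fun k _ => (hM j k).mul_const _)
    exact ⟨z, fun j => congrFun hz j, hz'⟩
  have summ : ∀ j, Summable fun k => M j k * x k := by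
    intro j
    refine Summable.of_norm (summable_of_sum_le (c := C * ‖x‖) (fun _ => norm_nonneg _) fun s => ?_)
    -- Phases are chosen so that coordinate $j$ of the image is $\sum_{k\in s}|M_{j,k}x_k|$. This
    -- gives absolute convergence of row $j$ even for $p=\infty$, where finitely supported vectors
    -- are not dense.
    have phase : ∀ z w : ℂ, ∃ v : ℂ, ‖v‖ ≤ ‖w‖ ∧ z * v = (‖z * w‖ : ℝ) := by
      intro z w
      rcases eq_or_ne z 0 with rfl | hz
      · exact ⟨0, by simp, by simp⟩
      · refine ⟨(‖z * w‖ : ℝ) / z, ?_, by field_simp⟩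
        have : ‖z‖ ≠ 0 := norm_ne_zero_iff.2 hz
        rw [norm_div, Complex.norm_real, norm_norm, norm_mul]
        field_simp
        exact le_rfl
    choose v hv1 hv2 using fun k => phase (M j k) (x k)
    obtain ⟨z, hz, hz'⟩ := finite s v hv1
    have e : z j = ((∑ k ∈ s, ‖M j k * x k‖ : ℝ) : ℂ) := by
      rw [hz, Complex.ofReal_sum]
      exact Finset.sum_congr rfl fun k _ => hv2 k
    have := (lp.norm_apply_le_norm zero_lt_exponent.ne' z j).trans hz'
    rw [e, Complex.norm_real] at this
    exact (le_abs_self _).trans this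
  choose z hz hz' using fun s : Finset J => finite s x fun _ => le_rfl
  obtain ⟨y, hy, hy'⟩ := exists_of_tendsto (l := atTop) hz' (f := fun j => ∑' k, M j k * x k)
    (fun j => by simp_rw [hz]; exact (summ j).hasSum)
  refine ⟨y, fun j => ?_, hy'⟩
  rw [hy]
  exact (summ j).hasSum

theorem generatesBounded_of_tendsto [DecidableEq J] {ι : Type*} {l : Filter ι} [l.NeBot]
    {B : ι → ell p J →L[ℂ] ell p J} {C : ℝ} (hB : ∀ i, ‖B i‖ ≤ C) {M : Matrix J J ℂ}
    (hM : ∀ j k, Tendsto (fun i => B i (lp.single p k 1) j) l (𝓝 (M j k))) :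
    GeneratesBounded p M := by
  refine ⟨max C 1, by positivity, fun x => ?_⟩
  obtain ⟨y, h, h'⟩ := exists_hasSum_of_tendsto hB hM x
  exact ⟨y, h, h'.trans (by gcongr; exact le_max_left _ _)⟩

theorem norm_generatedOp_le {M : Matrix J J ℂ} (h : GeneratesBounded p M) {C : ℝ} (hC : 0 ≤ C)
    (H : ∀ x : ell p J, ∃ y : ell p J, (∀ j, HasSum (fun k => M j k * x k) (y j)) ∧
      ‖y‖ ≤ C * ‖x‖) : ‖generatedOp h‖ ≤ C := by
  refine ContinuousLinearMap.opNorm_le_bound _ hC fun x => ?_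
  obtain ⟨y, hy, hle⟩ := H x
  have e : generatedOp h x = y := by
    ext j
    exact (hy j).tsum_eq
  rwa [e]

theorem hasSum_generatedOp {M : Matrix J J ℂ} (h : GeneratesBounded p M) (x : ell p J) (j : J) :
    HasSum (fun k => M j k * x k) (generatedOp h x j) :=
  h.hasSum x j

theorem generatedOp_single [DecidableEq J] {M : Matrix J J ℂ} (h : GeneratesBounded p M)
    (j k : J) : generatedOp h (lp.single p k 1) j = M j k := by
  rw [generatedOp_apply, tsum_eq_single k fun b hb => by rw [lp.single_apply_ne _ _ _ hb, mul_zero]]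
  simp

/-- The matrix of the compression of a shifted copy of an operator on `ℓ^p(ℕ₀)` to `ℓ^p(ℤ)` consists
of the entries `A_{j+n,k+n}`. -/
theorem exists_shift (A : ell p ℕ →L[ℂ] ell p ℕ) (n : ℕ) :
    ∃ B : ell p ℤ →L[ℂ] ell p ℤ, ‖B‖ ≤ ‖A‖ ∧ ∀ j k : ℤ, -(n : ℤ) ≤ j → -(n : ℤ) ≤ k →
      B (lp.single p k 1) j = A (lp.single p (k + n).toNat 1) (j + n).toNat := by
  -- $\mathbb N_0$ is placed in $\mathbb Z$ as $[-n,\infty)$, and the transported operator is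
  -- extended by zero.
  have hf : Function.Injective fun k : ℕ => (k : ℤ) - n := fun a b h => by
    simpa using h
  refine ⟨lpExt p hf ∘L A ∘L lpComp p hf, ?_, fun j k hj hk => ?_⟩
  · calc _ ≤ ‖lpExt p hf‖ * (‖A‖ * ‖lpComp p hf‖) :=
          (ContinuousLinearMap.opNorm_comp_le _ _).trans
            (mul_le_mul_of_nonneg_left (ContinuousLinearMap.opNorm_comp_le _ _) (norm_nonneg _))
      _ ≤ 1 * (‖A‖ * 1) := by
          gcongr
          · exact norm_lpExt_le hf
          · exact norm_lpComp_le hf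
      _ = ‖A‖ := by ring
  · obtain ⟨a, rfl⟩ : ∃ a : ℕ, j = (a : ℤ) - n := ⟨(j + n).toNat, by omega⟩
    obtain ⟨b, rfl⟩ : ∃ b : ℕ, k = (b : ℤ) - n := ⟨(k + n).toNat, by omega⟩
    simp only [ContinuousLinearMap.comp_apply, sub_add_cancel, Int.toNat_natCast]
    rw [lpComp_single hf b, lpExt_apply hf]

/-- If the entries `A_{j+n,k+n}` converge along a filter of `n` tending to infinity, then the limit
matrix satisfies the bound `‖A‖` on `ℓ^p(ℤ)`. -/
theorem exists_bounded_shift {l : Filter ℕ} (hl : l ≤ atTop)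
    (A : ell p ℕ →L[ℂ] ell p ℕ) {M : Matrix ℤ ℤ ℂ}
    (hM : ∀ j k : ℤ, Tendsto (fun n : ℕ =>
      A (lp.single p (k + n).toNat 1) (j + n).toNat) l (𝓝 (M j k))) :
    ∃ B : ℕ → ell p ℤ →L[ℂ] ell p ℤ, (∀ n, ‖B n‖ ≤ ‖A‖) ∧
      ∀ j k, Tendsto (fun n => B n (lp.single p k 1) j) l (𝓝 (M j k)) := by
  choose B hB hB' using exists_shift A
  refine ⟨B, hB, fun j k => (hM j k).congr' ?_⟩
  filter_upwards [hl (eventually_ge_atTop (-j).toNat), hl (eventually_ge_atTop (-k).toNat)]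
    with n hj hk
  rw [hB' n j k (by omega) (by omega)]

end Limits

/-! ### Fourier coefficients: existence and uniqueness. -/

section Fourier

open MeasureTheory AddCircle

theorem exists_fourierSeq_eq {φ : ℤ → ℂ} (h : Memℓp φ 2) : ∃ a : L1Circle, fourierSeq a = φ := by
  let f : Lp ℂ 2 (haarAddCircle (T := (1 : ℝ))) := fourierBasis.repr.symm ⟨φ, h⟩
  have hf : MemLp f 1 (haarAddCircle (T := (1 : ℝ))) :=
    (Lp.memLp f).mono_exponent (by norm_num)
  refine ⟨hf.toLp f, funext fun n => ?_⟩
  have e : fourierCoeff (hf.toLp f : AddCircle (1 : ℝ) → ℂ) n = fourierCoeff f n :=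
    congrFun (fourierCoeff_congr_ae hf.coeFn_toLp) n
  rw [fourierSeq, e, ← fourierBasis_repr]
  simp [f]

/-- The functional $g\mapsto\int gf$ is continuous in the sup norm and vanishes on the characters,
whose span is dense. -/
theorem integral_continuousMap_mul_eq_zero {f : AddCircle (1 : ℝ) → ℂ}
    (hf : Integrable f haarAddCircle) (h : ∀ n : ℤ, fourierCoeff f n = 0)
    (g : C(AddCircle (1 : ℝ), ℂ)) : ∫ t, g t * f t ∂haarAddCircle = 0 := by
  have hint : ∀ g : C(AddCircle (1 : ℝ), ℂ), Integrable (fun t => g t * f t) haarAddCircle :=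
    fun g => hf.bdd_mul g.continuous.aestronglyMeasurable
      (Eventually.of_forall fun t => g.norm_coe_le_norm t)
  let Λ : C(AddCircle (1 : ℝ), ℂ) →ₗ[ℂ] ℂ :=
    { toFun := fun g => ∫ t, g t * f t ∂haarAddCircle
      map_add' := fun g₁ g₂ => by
        rw [← integral_add (hint g₁) (hint g₂)]
        simp [add_mul]
      map_smul' := fun c g => by
        rw [RingHom.id_apply, smul_eq_mul, ← integral_const_mul]
        simp [mul_assoc] }
  let Λ' : C(AddCircle (1 : ℝ), ℂ) →L[ℂ] ℂ :=
    Λ.mkContinuous (∫ t, ‖f t‖ ∂haarAddCircle) fun g => by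
      change ‖∫ t, g t * f t ∂haarAddCircle‖ ≤ _
      rw [mul_comm, ← integral_const_mul]
      refine norm_integral_le_of_norm_le (hf.norm.const_mul _) (Eventually.of_forall fun t => ?_)
      rw [norm_mul]
      gcongr
      exact g.norm_coe_le_norm t
  have hΛ : Λ' = 0 := by
    refine ContinuousLinearMap.ext_on (s := Set.range (fourier (T := (1 : ℝ)))) ?_ ?_
    · rw [Submodule.dense_iff_topologicalClosure_eq_top]
      exact span_fourier_closure_eq_top
    · rintro _ ⟨n, rfl⟩
      have := h (-n)
      rw [fourierCoeff, neg_neg] at this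
      exact this
  exact congrArg (fun Φ : C(AddCircle (1 : ℝ), ℂ) →L[ℂ] ℂ => Φ g) hΛ

/-- It suffices to integrate over closed sets. The indicator of a closed set is a bounded pointwise
limit of continuous functions, so dominated convergence applies. -/
theorem ae_eq_zero_of_fourierCoeff_eq_zero {f : AddCircle (1 : ℝ) → ℂ}
    (hf : Integrable f haarAddCircle) (h : ∀ n : ℤ, fourierCoeff f n = 0) :
    f =ᵐ[haarAddCircle] 0 := by
  refine ae_eq_zero_of_forall_setIntegral_isClosed_eq_zero hf fun s hs => ?_
  let δ : ℕ → ℝ := fun n => 1 / ((n : ℝ) + 1)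
  have hδ : ∀ n, 0 < δ n := fun n => Nat.one_div_pos_of_nat
  let g : ℕ → C(AddCircle (1 : ℝ), ℂ) := fun n =>
    ⟨fun t => ((thickenedIndicator (hδ n) s t : ℝ) : ℂ), by fun_prop⟩
  have lim := thickenedIndicator_tendsto_indicator_closure hδ
    tendsto_one_div_add_atTop_nhds_zero_nat s
  rw [hs.closure_eq] at lim
  rw [← integral_indicator hs.measurableSet]
  have key : Tendsto (fun n => ∫ t, g n t * f t ∂haarAddCircle) atTop
      (𝓝 (∫ t, s.indicator f t ∂haarAddCircle)) := by
    refine tendsto_integral_of_dominated_convergence (fun t => ‖f t‖)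
      (fun n => (g n).continuous.aestronglyMeasurable.mul hf.aestronglyMeasurable) hf.norm
      (fun n => Eventually.of_forall fun t => ?_) (Eventually.of_forall fun t => ?_)
    · rw [norm_mul]
      refine mul_le_of_le_one_left (norm_nonneg _) ?_
      change ‖((thickenedIndicator (hδ n) s t : ℝ) : ℂ)‖ ≤ 1
      rw [Complex.norm_real, Real.norm_of_nonneg NNReal.zero_le_coe]
      exact_mod_cast thickenedIndicator_le_one (hδ n) s t
    · have ht := tendsto_pi_nhds.1 lim t
      have ht' : Tendsto (fun n => g n t) atTop
          (𝓝 (((s.indicator (fun _ => (1 : NNReal)) t : NNReal) : ℝ) : ℂ)) :=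
        (Complex.continuous_ofReal.tendsto _).comp ((NNReal.tendsto_coe.2 ht))
      convert ht'.mul_const (f t) using 2
      by_cases hts : t ∈ s <;> simp [hts]
  refine tendsto_nhds_unique key ?_
  simp_rw [integral_continuousMap_mul_eq_zero hf h]
  exact tendsto_const_nhds

theorem fourierSeq_injective : Function.Injective fourierSeq := by
  intro a b hab
  have ha := L1.integrable_coeFn a
  have hb := L1.integrable_coeFn b
  have h : ⇑a - ⇑b =ᵐ[haarAddCircle] 0 := by
    refine ae_eq_zero_of_fourierCoeff_eq_zero (ha.sub hb) fun n => ?_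
    have e : fourierCoeff a n = fourierCoeff b n := congrFun hab n
    have s : fourierCoeff ((⇑a - ⇑b) + ⇑b) n = fourierCoeff (⇑a - ⇑b) n + fourierCoeff b n := by
      rw [fourierCoeff.add (ha.sub hb) hb]
      rfl
    rw [sub_add_cancel, e] at s
    exact left_eq_add.1 (by rw [add_comm]; exact s)
  refine Lp.ext ?_
  filter_upwards [h] with t ht
  exact sub_eq_zero.1 ht

end Fourier

/-! ### Square summability of Laurent symbols. -/

section Laurent

variable {p : ℝ≥0∞} [Fact (1 ≤ p)]

/-- For $p<\infty$, since $|x_j|\le S$ for every $j$, $|x_j|^p\le|x_j|^2S^{p-2}$. -/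
theorem norm_le_of_sum_sq_le {J : Type} (hp : 2 ≤ p) {x : ell p J} {S : ℝ} (hS : 0 ≤ S)
    (h : ∀ s : Finset J, ∑ j ∈ s, ‖x j‖ ^ 2 ≤ S ^ 2) : ‖x‖ ≤ S := by
  have hx : ∀ j, ‖x j‖ ≤ S := fun j =>
    (sq_le_sq₀ (norm_nonneg _) hS).1 (by simpa using h {j})
  rcases eq_or_ne p ∞ with rfl | hp'
  · exact lp.norm_le_of_forall_le hS hx
  · have h2 : 2 ≤ p.toReal := by
      simpa using ENNReal.toReal_mono hp' hp
    refine lp.norm_le_of_forall_sum_le (by linarith) hS fun s => ?_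
    have split : ∀ r : ℝ, 0 ≤ r → r ^ p.toReal = r ^ 2 * r ^ (p.toReal - 2) := by
      intro r hr
      rw [← Real.rpow_natCast r 2, ← Real.rpow_add_of_nonneg hr (by norm_num) (by linarith)]
      norm_num
    calc ∑ j ∈ s, ‖x j‖ ^ p.toReal ≤ ∑ j ∈ s, ‖x j‖ ^ 2 * S ^ (p.toReal - 2) := by
          refine Finset.sum_le_sum fun j _ => ?_
          rw [split _ (norm_nonneg _)]
          gcongr
          exact hx j
      _ ≤ S ^ 2 * S ^ (p.toReal - 2) := by
          rw [← Finset.sum_mul]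
          gcongr
          exact h s
      _ = S ^ p.toReal := (split S hS).symm

/-- The symbol of a bounded Laurent operator is square summable. -/
theorem GeneratesBounded.memℓp_two {φ : ℤ → ℂ} (h : GeneratesBounded p (laurent φ)) :
    Memℓp φ 2 := by
  rcases le_total p 2 with hp | hp
  · have e : ⇑(generatedOp h (lp.single p 0 1)) = φ := by
      ext j
      rw [generatedOp_single, laurent, sub_zero]
    exact (e ▸ lp.memℓp _ : Memℓp φ p).of_exponent_ge hp
  · have hs : Summable fun k : ℤ => ‖φ (-k)‖ ^ 2 := by
      refine summable_of_sum_le (c := ‖generatedOp h‖ ^ 2) (fun _ => by positivity) fun t => ?_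
      set S := ∑ k ∈ t, ‖φ (-k)‖ ^ 2 with hS
      have hS0 : 0 ≤ S := Finset.sum_nonneg fun _ _ => by positivity
      -- For $p\ge2$, test on the conjugate of row $0$ cut to $t$: coordinate $0$ of the image is
      -- $S$, while $\|x\|_p\le\|x\|_2=\sqrt S$. So $S\le\|L\|\sqrt S$.
      let x : ell p ℤ := ∑ k ∈ t, lp.single p k (starRingEnd ℂ (φ (-k)))
      have hx : ‖x‖ ≤ √S := by
        refine norm_le_of_sum_sq_le hp (Real.sqrt_nonneg _) fun s => ?_
        rw [Real.sq_sqrt hS0]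
        calc ∑ j ∈ s, ‖x j‖ ^ 2 = ∑ j ∈ s, if j ∈ t then ‖φ (-j)‖ ^ 2 else 0 := by
              refine Finset.sum_congr rfl fun j _ => ?_
              simp only [x]
              rw [sum_single_apply]
              split_ifs <;> simp
          _ = ∑ j ∈ s ∩ t, ‖φ (-j)‖ ^ 2 := Finset.sum_ite_mem _ _ _
          _ ≤ S := Finset.sum_le_sum_of_subset_of_nonneg Finset.inter_subset_right
              fun _ _ _ => by positivity
      have e : generatedOp h x 0 = (S : ℂ) := by
        simp only [x]
        rw [map_sum_single_apply, hS, Complex.ofReal_sum]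
        refine Finset.sum_congr rfl fun k _ => ?_
        rw [generatedOp_single, laurent, zero_sub, Complex.mul_conj, Complex.normSq_eq_norm_sq]
      have hle : S ≤ ‖generatedOp h‖ * √S := by
        have := (lp.norm_apply_le_norm zero_lt_exponent.ne' (generatedOp h x) 0).trans
          ((generatedOp h).le_opNorm x)
        rw [e, Complex.norm_real, Real.norm_of_nonneg hS0] at this
        exact this.trans (by gcongr)
      rcases hS0.eq_or_lt with h0 | h0
      · rw [← h0]
        positivity
      · have hq := Real.sqrt_pos.2 h0
        have : √S ≤ ‖generatedOp h‖ := by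
          refine le_of_mul_le_mul_right ?_ hq
          rwa [Real.mul_self_sqrt hS0]
        calc S = √S ^ 2 := (Real.sq_sqrt hS0).symm
          _ ≤ _ := by gcongr
    have hs' : Summable fun k : ℤ => ‖φ k‖ ^ 2 := by
      simpa [Function.comp_def] using hs.comp_injective neg_injective
    exact memℓp_gen (by simpa using hs')

end Laurent

/-! ### Compact operators vanish along diagonals. -/

section Zero

variable {p : ℝ≥0∞} [Fact (1 ≤ p)] {J : Type}

theorem tendsto_cofinite_zero (hp : p ≠ ∞) (x : ell p J) : Tendsto x cofinite (𝓝 0) := by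
  have hp0 := toReal_exponent_pos hp
  have h := (lp.hasSum_norm hp0 x).summable.tendsto_cofinite_zero
  have h' := h.rpow_const (p := p.toReal⁻¹) (Or.inr (inv_nonneg.2 hp0.le))
  rw [Real.zero_rpow (inv_ne_zero hp0.ne')] at h'
  refine tendsto_zero_iff_norm_tendsto_zero.2 (h'.congr fun j => ?_)
  rw [← Real.rpow_mul (norm_nonneg _), mul_inv_cancel₀ hp0.ne', Real.rpow_one]

theorem tendsto_toNat_add (k : ℤ) : Tendsto (fun n : ℕ => (k + n).toNat) atTop atTop :=
  tendsto_atTop.2 fun b => by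
    filter_upwards [eventually_ge_atTop (b + (-k).toNat)] with n hn
    omega

/-- A sum of $N$ distinct unit sequences has sup norm at most $1$. If $N$ of their images were
within $\|v\|/2$ of $v\ne0$, then $N\|v\|/2\le\|K\|$, which fails for large $N$. -/
theorem eq_zero_of_tendsto_single {l : Filter ℕ} [l.NeBot] (hl : l ≤ cofinite)
    {E : Type*} [NormedAddCommGroup E] [NormedSpace ℂ E] (K : ell ∞ ℕ →L[ℂ] E) {v : E}
    (h : Tendsto (fun m => K (lp.single ∞ m 1)) l (𝓝 v)) : v = 0 := by
  by_contra hv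
  have hv' : 0 < ‖v‖ := norm_pos_iff.2 hv
  have hev : ∀ᶠ m in l, ‖K (lp.single ∞ m 1) - v‖ < ‖v‖ / 2 := by
    have := (tendsto_iff_norm_sub_tendsto_zero.1 h).eventually_lt_const (half_pos hv')
    exact this
  have hinf : {m | ‖K (lp.single ∞ m 1) - v‖ < ‖v‖ / 2}.Infinite :=
    frequently_cofinite_iff_infinite.1 (hev.frequently.filter_mono hl)
  obtain ⟨N, hN⟩ := exists_nat_gt (‖K‖ / (‖v‖ / 2))
  obtain ⟨t, ht, htc⟩ := hinf.exists_subset_card_eq N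
  let x : ell ∞ ℕ := ∑ m ∈ t, lp.single ∞ m 1
  have hx : ‖x‖ ≤ 1 := by
    refine lp.norm_le_of_forall_le zero_le_one fun j => ?_
    simp only [x]
    rw [sum_single_apply (fun _ => 1) t j]
    split_ifs <;> simp
  have h1 : ‖K x - N • v‖ ≤ N * (‖v‖ / 2) := by
    have e : K x - N • v = ∑ m ∈ t, (K (lp.single ∞ m 1) - v) := by
      rw [Finset.sum_sub_distrib, Finset.sum_const, htc, map_sum]
    rw [e]
    refine (norm_sum_le_of_le t fun m hm => (ht hm).le).trans ?_
    rw [Finset.sum_const, htc, nsmul_eq_mul]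
  have h2 : ‖K x‖ ≤ ‖K‖ := (K.le_opNorm x).trans (mul_le_of_le_one_right (norm_nonneg _) hx)
  have h3 : (N : ℝ) * ‖v‖ ≤ ‖K x‖ + ‖K x - N • v‖ := by
    have : ‖N • v‖ = N * ‖v‖ := by
      rw [← Nat.cast_smul_eq_nsmul ℝ, norm_smul, Real.norm_natCast]
    rw [← this]
    calc ‖N • v‖ = ‖K x - (K x - N • v)‖ := by rw [sub_sub_cancel]
      _ ≤ _ := norm_sub_le _ _
  rw [div_lt_iff₀ (half_pos hv')] at hN
  linarith

/-- The entries of a compact operator vanish along diagonals, at least along an ultrafilter. -/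
theorem tendsto_entry_of_isCompactOperator {K : ell p ℕ →L[ℂ] ell p ℕ} (hK : IsCompactOperator K)
    (j k : ℤ) : Tendsto (fun n : ℕ => K (lp.single p (k + n).toNat 1) (j + n).toNat)
      (hyperfilter ℕ) (𝓝 0) := by
  have hle : (hyperfilter ℕ : Filter ℕ) ≤ atTop := Nat.hyperfilter_le_atTop
  obtain ⟨Q, hQ, hQ'⟩ := hK.image_closedBall_subset_compact (f := (K : ell p ℕ →ₗ[ℂ] ell p ℕ)) 1
  let u : ℕ → ell p ℕ := fun n => K (lp.single p (k + n).toNat 1)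
  have hu : ∀ n, u n ∈ Q := fun n => hQ' ⟨_, by
    rw [mem_closedBall_zero_iff, lp.norm_single zero_lt_exponent, norm_one], rfl⟩
  obtain ⟨v, -, hv⟩ := hQ.ultrafilter_le_nhds' ((hyperfilter ℕ).map u)
    (Ultrafilter.mem_map.2 (Filter.univ_mem' hu))
  have hv : Tendsto u (hyperfilter ℕ) (𝓝 v) := hv
  have hv0 : Tendsto (fun n : ℕ => v (j + n).toNat) atTop (𝓝 0) := by
    -- For $p<\infty$ the coordinates of any $v\in\ell^p$ tend to zero. For $p=\infty$ this can
    -- fail, but there the limit $v$ is itself zero.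
    rcases eq_or_ne p ∞ with rfl | hp
    · have : v = 0 := by
        refine eq_zero_of_tendsto_single (l := map (fun n : ℕ => (k + n).toNat) (hyperfilter ℕ))
          ?_ K (tendsto_map'_iff.2 hv)
        rw [Nat.cofinite_eq_atTop]
        exact (map_mono hle).trans (tendsto_toNat_add k)
      rw [this]
      exact tendsto_const_nhds
    · have := tendsto_cofinite_zero hp v
      rw [Nat.cofinite_eq_atTop] at this
      exact this.comp (tendsto_toNat_add j)
  -- Norm convergence controls all coordinates uniformly, hence also the moving one.
  have hd : Tendsto (fun n : ℕ => (u n - v) (j + n).toNat) (hyperfilter ℕ) (𝓝 0) :=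
    squeeze_zero_norm (fun n => lp.norm_apply_le_norm zero_lt_exponent.ne' (u n - v) _)
      (tendsto_iff_norm_sub_tendsto_zero.1 hv)
  simpa [u] using hd.add (hv0.mono_left hle)

end Zero

/-! ### Displacement relations and Toeplitz plus Hankel matrices. -/

section Displacement

theorem hankel_apply (ψ : ℕ+ → ℂ) (j k : ℕ) : hankel ψ j k = ψ (Nat.succPNat (j + k)) := rfl

theorem toeplitz_apply (φ : ℤ → ℂ) (j k : ℕ) : toeplitz φ j k = φ ((j : ℤ) - k) := rfl

theorem displacementRelations_toeplitz_add_hankel (φ : ℤ → ℂ) (ψ : ℕ+ → ℂ) :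
    DisplacementRelations (toeplitz φ + hankel ψ) := by
  intro j k hj hk
  obtain ⟨j, rfl⟩ := Nat.exists_eq_add_of_le' hj
  obtain ⟨k, rfl⟩ := Nat.exists_eq_add_of_le' hk
  simp only [Matrix.add_apply, hankel_apply, toeplitz_apply, Nat.add_sub_cancel]
  have e1 : ((j : ℤ) - (k + 1 : ℕ)) = ((j + 1 : ℕ) : ℤ) - (k + 1 + 1 : ℕ) := by push_cast; ring
  have e2 : ((j + 1 + 1 : ℕ) : ℤ) - (k + 1 : ℕ) = ((j + 1 : ℕ) : ℤ) - k := by push_cast; ring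
  have e3 : j + (k + 1) = j + 1 + k := by ring
  have e4 : j + 1 + 1 + (k + 1) = j + 1 + (k + 1 + 1) := by ring
  rw [e1, e2, e3, e4]
  ring

theorem DisplacementRelations.exists_eq {M : Matrix ℕ ℕ ℂ} (h : DisplacementRelations M) {C : ℝ}
    (hC : ∀ j k, ‖M j k‖ ≤ C) :
    ∃ (φ : ell ∞ ℤ) (ψ : ell ∞ ℕ+), M = toeplitz φ + hankel ψ := by
  -- The increment along a diagonal depends only on $j+k$.
  have diff : ∀ k j, M (j + 1) (k + 1) - M j k = M (j + k + 1) 1 - M (j + k) 0 := by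
    intro k
    induction k with
    | zero => intro j; rfl
    | succ k ih =>
      intro j
      have h1 := h (j + 1) (k + 1) (by omega) (by omega)
      have h2 := ih (j + 1)
      rw [show j + 1 + k = j + (k + 1) by ring] at h2
      rw [← h2]
      simp only [Nat.add_sub_cancel] at h1
      linear_combination -h1
  -- The Hankel part is read off at the entry of the antidiagonal $j+k=n$ on or next to the main
  -- diagonal; being an entry of $M$, it is bounded by $C$.
  let d : ℕ → ℂ := fun n => M ((n + 1) / 2) (n / 2)
  let φ : ℤ → ℂ := fun m => M m.toNat (-m).toNat - d m.natAbs
  have hd : ∀ n, ‖d n‖ ≤ C := fun n => hC _ _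
  have step : ∀ j k, M (j + 1) (k + 1) - d (j + 1 + (k + 1)) = M j k - d (j + k) := by
    intro j k
    have h1 := diff k j
    have h2 := diff ((j + k) / 2) ((j + k + 1) / 2)
    rw [show (j + k + 1) / 2 + (j + k) / 2 = j + k by omega, ← h1] at h2
    have e : d (j + 1 + (k + 1)) = M ((j + k + 1) / 2 + 1) ((j + k) / 2 + 1) := by
      simp only [d]
      congr 1 <;> omega
    rw [e]
    linear_combination -h2
  have key : ∀ n j k, M (j + n) (k + n) - d (j + n + (k + n)) = M j k - d (j + k) := by
    intro n
    induction n with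
    | zero => intro j k; rfl
    | succ n ih =>
      intro j k
      rw [← ih j k, ← step (j + n) (k + n)]
      rfl
  refine ⟨⟨φ, memℓp_infty ⟨C + C, ?_⟩⟩, ⟨fun n => d n.natPred, memℓp_infty ⟨C, ?_⟩⟩, ?_⟩
  · rintro _ ⟨m, rfl⟩
    exact (norm_sub_le _ _).trans (add_le_add (hC _ _) (hd _))
  · rintro _ ⟨m, rfl⟩
    exact hd _
  · ext j k
    change M j k = φ ((j : ℤ) - k) + d (Nat.succPNat (j + k)).natPred
    rw [Nat.natPred_succPNat]
    -- Position $(j,k)$ is reached from the boundary point $(m^+,m^-)$, $m=j-k$, in $\min(j,k)$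
    -- diagonal steps.
    have := key (min j k) ((j : ℤ) - k).toNat (-((j : ℤ) - k)).toNat
    rw [show ((j : ℤ) - k).toNat + min j k = j by omega,
      show (-((j : ℤ) - k)).toNat + min j k = k by omega,
      show ((j : ℤ) - k).toNat + (-((j : ℤ) - k)).toNat = ((j : ℤ) - k).natAbs by omega] at this
    exact sub_eq_iff_eq_add.1 this

/-- The symbols of a Toeplitz plus Hankel matrix are unique if the Hankel part vanishes at
infinity. -/
theorem eq_of_toeplitz_add_hankel_eq {φ φ' : ℤ → ℂ} {ψ ψ' : ℕ+ → ℂ}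
    (hψ : Tendsto ψ atTop (𝓝 0)) (hψ' : Tendsto ψ' atTop (𝓝 0))
    (h : toeplitz φ + hankel ψ = toeplitz φ' + hankel ψ') : φ = φ' ∧ ψ = ψ' := by
  have hφ : φ = φ' := by
    funext m
    -- Along the $m$-th diagonal the Toeplitz entries stay fixed while the Hankel index tends to
    -- infinity.
    have e : ∀ n : ℕ, φ m - φ' m = ψ' (Nat.succPNat (m.toNat + n + ((-m).toNat + n))) -
        ψ (Nat.succPNat (m.toNat + n + ((-m).toNat + n))) := by
      intro n
      have := congrFun (congrFun h (m.toNat + n)) ((-m).toNat + n)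
      simp only [Matrix.add_apply, hankel_apply, toeplitz_apply] at this
      rw [show ((m.toNat + n : ℕ) : ℤ) - ((-m).toNat + n : ℕ) = m by omega] at this
      linear_combination this
    have ht : Tendsto (fun n : ℕ => Nat.succPNat (m.toNat + n + ((-m).toNat + n))) atTop atTop := by
      refine tendsto_atTop.2 fun b => ?_
      filter_upwards [eventually_ge_atTop (b : ℕ)] with n hn
      rw [← PNat.coe_le_coe, Nat.succPNat_coe]
      omega
    have lim := (hψ'.comp ht).sub (hψ.comp ht)
    rw [sub_zero] at lim
    exact sub_eq_zero.1 (tendsto_nhds_unique tendsto_const_nhds (lim.congr fun n => (e n).symm))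
  refine ⟨hφ, funext fun n => ?_⟩
  have := congrFun (congrFun h n.natPred) 0
  simp only [Matrix.add_apply, hankel_apply, hφ, add_zero, PNat.succPNat_natPred] at this
  exact add_left_cancel this

end Displacement

/-! ### Decay of Hankel symbols. -/

section Decay

variable {p : ℝ≥0∞} [Fact (1 ≤ p)]

/-- For $p<\infty$ the columns $Ae_k$ lie in $\ell^p$. For $p=\infty$ the matrix representation at
the constant sequence $1$ makes every row summable. -/
theorem tendsto_row_or_column {A : ell p ℕ →ₗ[ℂ] ell p ℕ} (hA : IsMatrixRepresented A) :
    (∀ k, Tendsto (fun j => matrixOf A j k) atTop (𝓝 0)) ∨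
      ∀ j, Tendsto (fun k => matrixOf A j k) atTop (𝓝 0) := by
  rcases eq_or_ne p ∞ with rfl | hp
  · right
    intro j
    have h := (hA (1 : ell ∞ ℕ) j).summable.tendsto_cofinite_zero
    rw [Nat.cofinite_eq_atTop] at h
    simpa using h
  · left
    intro k
    have h := tendsto_cofinite_zero hp (A (lp.single p k 1))
    rwa [Nat.cofinite_eq_atTop] at h

/-- The Toeplitz part cancels in $A_{n+1,1}-A_{n,0}$ and in $A_{1,n+1}-A_{0,n}$; both equal
$d(n+2)-d(n)$. -/
theorem tendsto_hankel_sub {A : ell p ℕ →ₗ[ℂ] ell p ℕ} (hA : IsMatrixRepresented A)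
    {φ : ℤ → ℂ} {d : ℕ → ℂ} (h : ∀ j k : ℕ, matrixOf A j k = φ ((j : ℤ) - k) + d (j + k)) :
    Tendsto (fun n => d (n + 2) - d n) atTop (𝓝 0) := by
  rcases tendsto_row_or_column hA with hA | hA
  · have h0 := hA 0
    have h1 := (hA 1).comp (tendsto_add_atTop_nat 1)
    have := h1.sub h0
    rw [sub_zero] at this
    refine this.congr fun n => ?_
    simp only [Function.comp, h]
    push_cast
    rw [show (n : ℤ) + 1 - 1 = n - 0 by ring]
    ring_nf
  · have h0 := hA 0
    have h1 := (hA 1).comp (tendsto_add_atTop_nat 1)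
    have := h1.sub h0
    rw [sub_zero] at this
    refine this.congr fun n => ?_
    simp only [Function.comp, h]
    push_cast
    rw [show (1 : ℤ) - (n + 1) = 0 - n by ring]
    ring_nf

/-- Limits of a slowly varying sequence along an ultrafilter are constant on parity classes. -/
theorem exists_parity_limit {d : ℕ → ℂ} {C : ℝ} (hC : ∀ n, ‖d n‖ ≤ C)
    (hd : Tendsto (fun n => d (n + 2) - d n) atTop (𝓝 0)) :
    ∃ α : ℤ → ℂ, (∀ m k, α (m - k) = α (m + k)) ∧
      ∀ s : ℤ, Tendsto (fun n : ℕ => d (2 * n + s).toNat) (hyperfilter ℕ) (𝓝 (α s)) := by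
  have lim : ∀ u : ℕ → ℕ, ∃ z, Tendsto (fun n => d (u n)) (hyperfilter ℕ) (𝓝 z) := by
    intro u
    obtain ⟨z, -, hz⟩ := (isCompact_closedBall (0 : ℂ) C).ultrafilter_le_nhds'
      ((hyperfilter ℕ).map fun n => d (u n))
      (Ultrafilter.mem_map.2 (Filter.univ_mem' fun n => by simpa using hC (u n)))
    exact ⟨z, hz⟩
  obtain ⟨z₀, h₀⟩ := lim fun n => 2 * n
  obtain ⟨z₁, h₁⟩ := lim fun n => 2 * n + 1
  -- Slow variation of $d$ makes a shift of the index by $2$ invisible in the limit.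
  have shift : ∀ s : ℤ, Tendsto (fun n : ℕ => d (2 * n + (s + 2)).toNat - d (2 * n + s).toNat)
      (hyperfilter ℕ) (𝓝 0) := by
    intro s
    have ht : Tendsto (fun n : ℕ => (2 * n + s).toNat) atTop atTop :=
      tendsto_atTop.2 fun b => by
        filter_upwards [eventually_ge_atTop (b + (-s).toNat)] with n hn
        omega
    refine ((hd.comp ht).congr' ?_).mono_left Nat.hyperfilter_le_atTop
    filter_upwards [eventually_ge_atTop (-s).toNat] with n hn
    simp only [Function.comp]
    rw [show (2 * (n : ℤ) + (s + 2)).toNat = (2 * n + s).toNat + 2 by omega]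
  have iter : ∀ (r : ℤ) (z : ℂ),
      Tendsto (fun n : ℕ => d (2 * n + r).toNat) (hyperfilter ℕ) (𝓝 z) → ∀ t : ℤ,
      Tendsto (fun n : ℕ => d (2 * n + (r + 2 * t)).toNat) (hyperfilter ℕ) (𝓝 z) := by
    intro r z hr t
    induction t using Int.induction_on with
    | zero => simpa using hr
    | succ t ih =>
      have := ih.add (shift (r + 2 * t))
      rw [add_zero] at this
      refine this.congr fun n => ?_
      rw [show r + 2 * ((t : ℤ) + 1) = r + 2 * t + 2 by ring]
      ring
    | pred t ih =>
      have := ih.sub (shift (r + 2 * (-t - 1)))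
      rw [sub_zero] at this
      refine this.congr fun n => ?_
      rw [show r + 2 * (-(t : ℤ) - 1) + 2 = r + 2 * -t by ring]
      ring
  refine ⟨fun s => if Even s then z₀ else z₁, fun m k => ?_, fun s => ?_⟩
  · simp only [Int.even_add, Int.even_sub]
  · rcases Int.even_or_odd' s with ⟨t, rfl | rfl⟩
    · have := iter 0 z₀ (h₀.congr fun n => by congr 1) t
      simpa using this
    · have := iter 1 z₁ (h₁.congr fun n => by congr 1) t
      have ho : ¬Even (1 + 2 * t) := by simp [Int.even_add]
      simp only [add_comm (2 * t) 1, if_neg ho]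
      exact this

theorem tendsto_zero_of_hankel {ψ : ℕ+ → ℂ} (h : GeneratesBounded p (hankel ψ)) :
    Tendsto ψ atTop (𝓝 0) := by
  have hmat : matrixOf (generatedOp h : ell p ℕ →ₗ[ℂ] ell p ℕ) = hankel ψ := by
    ext j k
    exact generatedOp_single h j k
  have hrep : IsMatrixRepresented (generatedOp h : ell p ℕ →ₗ[ℂ] ell p ℕ) := by
    intro x j
    rw [hmat]
    exact hasSum_generatedOp h x j
  have lim : Tendsto (fun n => ψ (Nat.succPNat n)) atTop (𝓝 0) := by
    rcases tendsto_row_or_column hrep with H | H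
    · simpa [hmat, hankel_apply] using H 0
    · simpa [hmat, hankel_apply] using H 0
  have ht : Tendsto PNat.natPred atTop atTop :=
    tendsto_atTop.2 fun b => by
      filter_upwards [eventually_ge_atTop (Nat.succPNat b)] with n hn
      rw [← PNat.coe_le_coe, Nat.succPNat_coe] at hn
      rw [PNat.natPred]
      omega
  simpa [Function.comp_def] using lim.comp ht

end Decay

/-! ### The normalized decomposition. -/

section Structure

variable {p : ℝ≥0∞} [Fact (1 ≤ p)]

theorem exists_mp_hankelSymbol {A : ell p ℕ →L[ℂ] ell p ℕ}
    (hA : IsMatrixRepresented (A : ell p ℕ →ₗ[ℂ] ell p ℕ)) {φ : ℤ → ℂ} {ψ : ell ∞ ℕ+}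
    (h : matrixOf (A : ell p ℕ →ₗ[ℂ] ell p ℕ) = toeplitz φ + hankel ψ) :
    ∃ (a : Mp p) (ϱ : HankelSymbol p), A = toeplitzOp a + hankelOp ϱ := by
  have hd := tendsto_hankel_sub hA (d := fun n => ψ (Nat.succPNat n))
    fun j k => congrFun (congrFun h j) k
  obtain ⟨α, hα, lim⟩ := exists_parity_limit
    (fun n => lp.norm_apply_le_norm ENNReal.top_ne_zero ψ _) hd
  have entries : ∀ j k : ℤ, Tendsto (fun n : ℕ => A (lp.single p (k + n).toNat 1) (j + n).toNat)
      (hyperfilter ℕ) (𝓝 (laurent (fun m => φ m + α m) j k)) := by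
    intro j k
    rw [laurent, hα j k]
    refine ((lim (j + k)).const_add (φ (j - k))).congr' ?_
    filter_upwards [Nat.hyperfilter_le_atTop (eventually_ge_atTop (-j).toNat),
      Nat.hyperfilter_le_atTop (eventually_ge_atTop (-k).toNat)] with n hj hk
    have e : A (lp.single p (k + n).toNat 1) (j + n).toNat =
        φ (((j + n).toNat : ℤ) - (k + n).toNat) + ψ (Nat.succPNat ((j + n).toNat + (k + n).toNat)) :=
      congrFun (congrFun h _) _
    rw [e, show ((j + n).toNat : ℤ) - (k + n).toNat = j - k by omega,
      show (j + n).toNat + (k + n).toNat = (2 * n + (j + k)).toNat by omega]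
  obtain ⟨B, hB, hB'⟩ := exists_bounded_shift Nat.hyperfilter_le_atTop A entries
  have hL : GeneratesBounded p (laurent fun m => φ m + α m) := generatesBounded_of_tendsto hB hB'
  obtain ⟨a, ha⟩ := exists_fourierSeq_eq hL.memℓp_two
  let a' : Mp p := ⟨a, ha ▸ hL⟩
  have hT : ∀ j k, toeplitz (fourierSeq a) j k = φ ((j : ℤ) - k) + α ((j : ℤ) - k) := by
    intro j k
    rw [ha]
    rfl
  -- The predecessor of the Hankel index $j+k+1$ is $j+k$, and $\alpha_{j+k}=\alpha_{j-k}$: what the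
  -- Toeplitz part gains, the Hankel part loses.
  let ϱ : ℕ+ → ℂ := fun n => ψ n - α (n.natPred : ℤ)
  have hsum : ∀ x j, HasSum (fun k => hankel ϱ j k * x k) ((A - toeplitzOp a') x j) := by
    intro x j
    have e : ∀ k, hankel ϱ j k * x k = matrixOf (A : ell p ℕ →ₗ[ℂ] ell p ℕ) j k * x k -
        toeplitz (fourierSeq a) j k * x k := by
      intro k
      rw [h, Matrix.add_apply, hT, hankel_apply, hankel_apply, toeplitz_apply, hα]
      simp only [ϱ, Nat.natPred_succPNat]
      push_cast
      ring
    simp_rw [e]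
    exact (hA x j).sub (hasSum_generatedOp a'.2.toeplitz x j)
  have hH : GeneratesBounded p (hankel ϱ) := by
    refine ⟨‖A - toeplitzOp a'‖ + 1, by positivity, fun x => ⟨_, hsum x, ?_⟩⟩
    exact ((A - toeplitzOp a').le_opNorm x).trans (by gcongr; linarith)
  refine ⟨a', ⟨ϱ, tendsto_zero_of_hankel hH, hH⟩, ?_⟩
  rw [← sub_eq_iff_eq_add']
  ext x j
  exact (hsum x j).unique (hasSum_generatedOp hH x j)

theorem matrixOf_toeplitzOp_add_hankelOp (a : Mp p) (ϱ : HankelSymbol p) :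
    matrixOf ((toeplitzOp a + hankelOp ϱ : ell p ℕ →L[ℂ] ell p ℕ) : ell p ℕ →ₗ[ℂ] ell p ℕ) =
      toeplitz (fourierSeq a.1) + hankel ϱ.1 := by
  ext j k
  exact congrArg₂ (· + ·) (generatedOp_single a.2.toeplitz j k) (generatedOp_single ϱ.2.2 j k)

theorem isMatrixRepresented_toeplitzOp_add_hankelOp (a : Mp p) (ϱ : HankelSymbol p) :
    IsMatrixRepresented
      ((toeplitzOp a + hankelOp ϱ : ell p ℕ →L[ℂ] ell p ℕ) : ell p ℕ →ₗ[ℂ] ell p ℕ) := by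
  intro x j
  rw [matrixOf_toeplitzOp_add_hankelOp]
  simp only [Matrix.add_apply, add_mul]
  exact (hasSum_generatedOp a.2.toeplitz x j).add (hasSum_generatedOp ϱ.2.2 x j)

end Structure

/-! ### Norm and essential norm estimates. -/

section Norms

variable {p : ℝ≥0∞} [Fact (1 ≤ p)]

/-- Along the diagonals only the Laurent entries survive in the limit. The case $K=0$ serves the
operator norm, general $K$ the essential norm. -/
theorem Mp.norm_le_norm_add {a : Mp p} {ϱ : HankelSymbol p} {K : ell p ℕ →L[ℂ] ell p ℕ}
    (hK : IsCompactOperator K) : a.norm ≤ ‖toeplitzOp a + hankelOp ϱ + K‖ := by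
  have entries : ∀ j k : ℤ, Tendsto (fun n : ℕ =>
      (toeplitzOp a + hankelOp ϱ + K) (lp.single p (k + n).toNat 1) (j + n).toNat)
      (hyperfilter ℕ) (𝓝 (laurent (fourierSeq a.1) j k)) := by
    intro j k
    have ht : Tendsto (fun n : ℕ => Nat.succPNat ((j + n).toNat + (k + n).toNat)) atTop atTop :=
      tendsto_atTop.2 fun b => by
        filter_upwards [eventually_ge_atTop ((b : ℕ) + (-j).toNat)] with n hn
        rw [← PNat.coe_le_coe, Nat.succPNat_coe]
        omega
    have lim := (((ϱ.2.1.comp ht).mono_left Nat.hyperfilter_le_atTop).const_add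
      (laurent (fourierSeq a.1) j k)).add (tendsto_entry_of_isCompactOperator hK j k)
    rw [add_zero, add_zero] at lim
    refine lim.congr' ?_
    filter_upwards [Nat.hyperfilter_le_atTop (eventually_ge_atTop (-j).toNat),
      Nat.hyperfilter_le_atTop (eventually_ge_atTop (-k).toNat)] with n hj hk
    have e := congrFun (congrFun (matrixOf_toeplitzOp_add_hankelOp a ϱ) (j + n).toNat) (k + n).toNat
    rw [Matrix.add_apply, toeplitz_apply,
      show ((j + n).toNat : ℤ) - (k + n).toNat = j - k by omega] at e
    exact congrArg (· + K (lp.single p (k + n).toNat 1) (j + n).toNat) e.symm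
  obtain ⟨B, hB, hB'⟩ := exists_bounded_shift Nat.hyperfilter_le_atTop _ entries
  exact norm_generatedOp_le a.2 (norm_nonneg _) (exists_hasSum_of_tendsto hB hB')

theorem norm_toeplitzOp_le (a : Mp p) : ‖toeplitzOp a‖ ≤ a.norm := by
  have hf : Function.Injective (Nat.cast : ℕ → ℤ) := Nat.cast_injective
  let B : ell p ℕ →L[ℂ] ell p ℕ := lpComp p hf ∘L generatedOp a.2 ∘L lpExt p hf
  have hB : ‖B‖ ≤ a.norm := by
    calc ‖B‖ ≤ ‖lpComp p hf‖ * (‖generatedOp a.2‖ * ‖lpExt p hf‖) :=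
          (ContinuousLinearMap.opNorm_comp_le _ _).trans
            (mul_le_mul_of_nonneg_left (ContinuousLinearMap.opNorm_comp_le _ _) (norm_nonneg _))
      _ ≤ 1 * (‖generatedOp a.2‖ * 1) := by
          gcongr
          · exact norm_lpComp_le hf
          · exact norm_lpExt_le hf
      _ = a.norm := by rw [one_mul, mul_one, Mp.norm]
  have entry : ∀ j k, B (lp.single p k 1) j = toeplitz (fourierSeq a.1) j k := fun j k => by
    have e : lpExt p hf (lp.single p k 1) = lp.single p (k : ℤ) 1 := lpExt_single hf k 1
    simp only [B, ContinuousLinearMap.comp_apply]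
    rw [e, lpComp_apply, generatedOp_single]
    rfl
  -- The limit lemma for a constant family turns equality of entries into a norm bound; for
  -- $p=\infty$ continuity and density would not suffice.
  refine norm_generatedOp_le a.2.toeplitz (norm_nonneg _)
    (exists_hasSum_of_tendsto (l := (pure () : Filter Unit)) (B := fun _ => B) (fun _ => hB)
      fun j k => ?_)
  rw [entry]
  exact tendsto_const_nhds

theorem essNorm_le {A K : ell p ℕ →L[ℂ] ell p ℕ} (hK : IsCompactOperator K) :
    essNorm A ≤ ‖A + K‖ :=
  csInf_le ⟨0, by rintro _ ⟨K, -, rfl⟩; exact norm_nonneg _⟩ ⟨K, hK, rfl⟩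

theorem le_essNorm {A : ell p ℕ →L[ℂ] ell p ℕ} {r : ℝ}
    (h : ∀ K : ell p ℕ →L[ℂ] ell p ℕ, IsCompactOperator K → r ≤ ‖A + K‖) : r ≤ essNorm A :=
  le_csInf ⟨_, 0, isCompactOperator_zero, rfl⟩ (by rintro _ ⟨K, hK, rfl⟩; exact h K hK)

/-- Any compact perturbation of $B$ is also admissible for $A$. -/
theorem essNorm_le_add_norm_sub (A B : ell p ℕ →L[ℂ] ell p ℕ) :
    essNorm A ≤ essNorm B + ‖A - B‖ := by
  rw [← sub_le_iff_le_add]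
  refine le_essNorm fun K hK => ?_
  rw [sub_le_iff_le_add]
  calc essNorm A ≤ ‖A + K‖ := essNorm_le hK
    _ = ‖(B + K) + (A - B)‖ := by congr 1; abel
    _ ≤ _ := norm_add_le _ _

end Norms

end ToeplitzHankel

end

/-! ### The main theorem. -/

theorem mainTheorem1 (p : ℝ≥0∞) [Fact (1 ≤ p)] :
    -- the equivalence of (i), (ii) and (iii)
    (∀ A : ell p ℕ →ₗ[ℂ] ell p ℕ,
      [ IsBoundedLinearMap ℂ A ∧ IsMatrixRepresented A ∧
          DisplacementRelations (matrixOf A),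
        IsBoundedLinearMap ℂ A ∧ IsMatrixRepresented A ∧
          ∃ (φ : ell ∞ ℤ) (ψ : ell ∞ ℕ+),
            matrixOf A = toeplitz φ + hankel ψ,
        ∃ (a : Mp p) (ϱ : HankelSymbol p),
          A = toeplitzOp a + hankelOp ϱ ].TFAE) ∧
    -- uniqueness of `a` and `ϱ`
    (∀ (a b : Mp p) (ϱ σ : HankelSymbol p),
      toeplitzOp a + hankelOp ϱ =
        toeplitzOp b + hankelOp σ → a = b ∧ ϱ = σ) ∧
    -- equivalence of norms, with constants that do not depend on `a` and `ϱ`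
    (∃ c C : ℝ, 0 < c ∧ 0 < C ∧ ∀ (a : Mp p) (ϱ : HankelSymbol p),
        c * max a.norm ‖hankelOp ϱ‖ ≤
            ‖toeplitzOp a + hankelOp ϱ‖ ∧
          ‖toeplitzOp a + hankelOp ϱ‖ ≤
            C * max a.norm ‖hankelOp ϱ‖) ∧
    -- equivalence of essential norms
    (∃ c C : ℝ, 0 < c ∧ 0 < C ∧ ∀ (a : Mp p) (ϱ : HankelSymbol p),
        c * max a.norm (essNorm (hankelOp ϱ)) ≤
            essNorm (toeplitzOp a + hankelOp ϱ) ∧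
          essNorm (toeplitzOp a + hankelOp ϱ) ≤
            C * max a.norm (essNorm (hankelOp ϱ))) := by

  -- The constants come from $\|H\|\le\|T+H\|+\|T\|\le2\|T+H\|$ and $\|T+H\|\le\|T\|+\|H\|$, with
  -- $\|T\|\le\|a\|_{M^p}\le\|T+H\|_{\mathrm{ess}}\le\|T+H\|$. The essential norms obey the same
  -- inequalities.
  refine ⟨fun A => ?_, fun a b ϱ σ h => ?_, ⟨1 / 2, 2, by norm_num, by norm_num, fun a ϱ => ?_⟩,
    ⟨1 / 2, 2, by norm_num, by norm_num, fun a ϱ => ?_⟩⟩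
  · tfae_have 1 → 2 := by
      rintro ⟨hb, hm, hd⟩
      obtain ⟨C, -, hC⟩ := hb.bound
      refine ⟨hb, hm, hd.exists_eq (C := C) fun j k => ?_⟩
      refine (lp.norm_apply_le_norm zero_lt_exponent.ne' (A (lp.single p k 1)) j).trans ?_
      simpa [lp.norm_single zero_lt_exponent] using hC (lp.single p k 1)
    tfae_have 2 → 3 := by
      rintro ⟨hb, hm, φ, ψ, h⟩
      obtain ⟨a, ϱ, e⟩ := exists_mp_hankelSymbol (A := hb.toContinuousLinearMap) hm h
      exact ⟨a, ϱ, congrArg (fun B : ell p ℕ →L[ℂ] ell p ℕ => (B : ell p ℕ →ₗ[ℂ] ell p ℕ)) e⟩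
    tfae_have 3 → 1 := by
      rintro ⟨a, ϱ, h⟩
      have h' : A = ((toeplitzOp a + hankelOp ϱ : ell p ℕ →L[ℂ] ell p ℕ) :
        ell p ℕ →ₗ[ℂ] ell p ℕ) := h
      rw [h']
      refine ⟨(toeplitzOp a + hankelOp ϱ).isBoundedLinearMap,
        isMatrixRepresented_toeplitzOp_add_hankelOp a ϱ, ?_⟩
      rw [matrixOf_toeplitzOp_add_hankelOp]
      exact displacementRelations_toeplitz_add_hankel _ _
    tfae_finish
  · have e := matrixOf_toeplitzOp_add_hankelOp a ϱ
    rw [h, matrixOf_toeplitzOp_add_hankelOp b σ] at e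
    obtain ⟨h1, h2⟩ := eq_of_toeplitz_add_hankel_eq σ.2.1 ϱ.2.1 e
    exact ⟨Subtype.ext (fourierSeq_injective h1.symm), Subtype.ext h2.symm⟩
  · have h1 : a.norm ≤ ‖toeplitzOp a + hankelOp ϱ‖ := by
      simpa using Mp.norm_le_norm_add (a := a) (ϱ := ϱ) (K := 0) isCompactOperator_zero
    have h2 := norm_toeplitzOp_le a
    have h3 := norm_add_le (toeplitzOp a) (hankelOp ϱ)
    have h4 : ‖hankelOp ϱ‖ ≤ ‖toeplitzOp a + hankelOp ϱ‖ + ‖toeplitzOp a‖ := by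
      simpa using norm_sub_le (toeplitzOp a + hankelOp ϱ) (toeplitzOp a)
    have h5 := norm_nonneg (toeplitzOp a + hankelOp ϱ)
    refine ⟨?_, ?_⟩
    · have := max_le (c := 2 * ‖toeplitzOp a + hankelOp ϱ‖) (by linarith : a.norm ≤ _)
        (by linarith : ‖hankelOp ϱ‖ ≤ _)
      linarith
    · linarith [le_max_left a.norm ‖hankelOp ϱ‖, le_max_right a.norm ‖hankelOp ϱ‖]
  · have h1 : a.norm ≤ essNorm (toeplitzOp a + hankelOp ϱ) :=
      le_essNorm fun K hK => Mp.norm_le_norm_add hK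
    have h2 := norm_toeplitzOp_le a
    have h3 : essNorm (toeplitzOp a + hankelOp ϱ) ≤ essNorm (hankelOp ϱ) + ‖toeplitzOp a‖ := by
      simpa using essNorm_le_add_norm_sub (toeplitzOp a + hankelOp ϱ) (hankelOp ϱ)
    have h4 : essNorm (hankelOp ϱ) ≤ essNorm (toeplitzOp a + hankelOp ϱ) + ‖toeplitzOp a‖ := by
      simpa using essNorm_le_add_norm_sub (hankelOp ϱ) (toeplitzOp a + hankelOp ϱ)
    have h5 : 0 ≤ essNorm (toeplitzOp a + hankelOp ϱ) := le_essNorm fun K _ => norm_nonneg _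
    refine ⟨?_, ?_⟩
    · have := max_le (c := 2 * essNorm (toeplitzOp a + hankelOp ϱ)) (by linarith : a.norm ≤ _)
        (by linarith : essNorm (hankelOp ϱ) ≤ _)
      linarith
    · linarith [le_max_left a.norm (essNorm (hankelOp ϱ)),
        le_max_right a.norm (essNorm (hankelOp ϱ))]
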